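/- Let $(\mathcal C, C)$ be an additive braided tensor category (with bi-additive tensor product $\otimes$ and braiding $C$; associators are suppressed), and let $A$, $H$ be objects such that $C$ is symmetric on $\{A,H\}$, i.e. $C_{U,V}=C_{V,U}^{-1}$ for $U,V\in\{A,H\}$. A braided Lie algebra $(L,[\,,])$ is an object $L$ on which $C$ is symmetric with a morphism $[\,,]:L\otimes L\to L$ such that $[\,,](\mathrm{id}+C)=0$ and $[\,,]([\,,]\otimes\mathrm{id})(\mathrm{id}+C_{12}C_{23}+C_{23}C_{12})=0$; a braided Lie coalgebra $(L,\delta)$ is an object $L$ on which $C$ is symmetric with a morphism $\delta:L\to L\otimes L$ such that $(\mathrm{id}+C)\delta=0$ and $(\mathrm{id}+C_{12}C_{23}+C_{23}C_{12})(\delta\otimes\mathrm{id})\delta=0$. Put $$\Lambda_L=\big(([\,,]\otimes\mathrm{id})(\mathrm{id}\otimes\delta)+(\mathrm{id}\otimes[\,,])(C\otimes\mathrm{id})(\mathrm{id}\otimes\delta)\big)(\mathrm{id}\otimes\mathrm{id}-C_{L,L}).$$ A braided Lie bialgebra is a braided Lie algebra and braided Lie coalgebra $(L,[\,,],\delta)$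 with $\delta[\,,]=\Lambda_L$. Let $(A,[\,,]_A,\delta_A)$ be a braided Lie bialgebra, and let $\beta:H\otimes A\to H$, $\psi:H\to H\otimes A$, $[\,,]_H:H\otimes H\to H$, $\delta_H:H\to H\otimes H$ be morphisms such that $H$ is a right $A$-infinitesimal braided Lie bialgebra, that is: 1. $(H,[\,,]_H)$ is a braided Lie algebra and $(H,\delta_H)$ is a braided Lie coalgebra; 2. $H$ is a right $A$-module and right $A$-comodule: $\beta(\mathrm{id}\otimes[\,,]_A)=\beta(\beta\otimes\mathrm{id})(\mathrm{id}-\mathrm{id}\otimes C_{A,A})$ and $(\mathrm{id}\otimes\delta_A)\psi=(\mathrm{id}-\mathrm{id}\otimes C_{A,A})(\psi\otimes\mathrm{id})\psi$; 3. $H$ is a right Yetter–Drinfeld module: $\psi\beta=(\mathrm{id}\otimes[\,,]_A)(\psi\otimes\mathrm{id})+(\beta\otimes\mathrm{id})(\mathrm{id}\otimes C_{A,A})(\psi\otimes\mathrm{id})+(\beta\otimes\mathrm{id})(\mathrm{id}\otimes\delta_A)$; 4. $[\,,]_H$ and $\delta_H$ are morphisms of right $A$-modules and of right $A$-comodules,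 where $H\otimes H$ carries the action $\mathrm{id}\otimes\beta+(\beta\otimes\mathrm{id})(\mathrm{id}\otimes C_{H,A})$ and the coaction $\mathrm{id}\otimes\psi+(\mathrm{id}\otimes C_{A,H})(\psi\otimes\mathrm{id})$; 5. $\delta_H[\,,]_H=\Lambda_H-{}^SC$, where ${}^SC:H\otimes H\to H\otimes H$ is the infinitesimal braiding $$\begin{aligned}{}^SC={}&(\mathrm{id}\otimes\beta)(\mathrm{id}\otimes C_{A,H})(\psi\otimes\mathrm{id})+(\beta\otimes\mathrm{id})(\mathrm{id}\otimes C_{H,A})(\mathrm{id}\otimes\psi)\\&-(\mathrm{id}\otimes\beta)(C_{H,H}\otimes\mathrm{id})(\mathrm{id}\otimes\psi)\\&-(\beta\otimes\mathrm{id})(\mathrm{id}\otimes C_{H,A})(C_{H,H}\otimes\mathrm{id})(\mathrm{id}\otimes C_{A,H})(\psi\otimes\mathrm{id}).\end{aligned}$$ Then the bisum of $A$ and $H$ along $\beta$ and $\psi$ is a braided Lie bialgebra in $\mathcal C$. Here the bisum is the object $D=A\oplus H$, with canonical injections $\iota_A,\iota_H$ and projections $\pi_A,\pi_H$, together with the bracket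 and cobracket $$[\,,]_D=\iota_A[\,,]_A(\pi_A\otimes\pi_A)+\iota_H\big([\,,]_H(\pi_H\otimes\pi_H)+\beta(\pi_H\otimes\pi_A)-\beta C_{A,H}(\pi_A\otimes\pi_H)\big),$$ $$\delta_D=(\iota_A\otimes\iota_A)\delta_A\pi_A+\big((\iota_H\otimes\iota_H)\delta_H+(\iota_H\otimes\iota_A)\psi-(\iota_A\otimes\iota_H)C_{H,A}\psi\big)\pi_H.$$ -/

import Mathlib

open CategoryTheory MonoidalCategory

universe v u

namespace BraidedLie



section Basic

variable {C : Type u} [Category.{v} C] [MonoidalCategory C] [BraidedCategory C]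

/-- The braiding is symmetric on a family of objects: `C_{U,V} = (C_{V,U})⁻¹` for all `U`, `V`
in the family. -/
def SymmetricOn (E : Set C) : Prop :=
  ∀ U ∈ E, ∀ V ∈ E, (β_ U V).hom = (β_ V U).inv

/-- `C_{X,Y} ⊗ id_Z`. -/
def swap12 (X Y Z : C) : (X ⊗ Y) ⊗ Z ⟶ (Y ⊗ X) ⊗ Z :=
  (β_ X Y).hom ▷ Z

/-- `id_X ⊗ C_{Y,Z}`. -/
def swap23 (X Y Z : C) : (X ⊗ Y) ⊗ Z ⟶ (X ⊗ Z) ⊗ Y :=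
  (α_ X Y Z).hom ≫ X ◁ (β_ Y Z).hom ≫ (α_ X Z Y).inv

variable [Preadditive C]

/-- Braided Lie algebras `(L, [,])`. Composition is written in diagrammatic order. -/
structure IsBraidedLieAlgebra (L : C) (br : L ⊗ L ⟶ L) : Prop where
  symm : SymmetricOn {L}
  antisymm : (𝟙 (L ⊗ L) + (β_ L L).hom) ≫ br = 0
  jacobi :
    (𝟙 ((L ⊗ L) ⊗ L) + swap23 L L L ≫ swap12 L L L + swap12 L L L ≫ swap23 L L L) ≫
      br ▷ L ≫ br = 0

/-- Braided Lie coalgebras `(L, δ)`. -/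
structure IsBraidedLieCoalgebra (L : C) (δ : L ⟶ L ⊗ L) : Prop where
  symm : SymmetricOn {L}
  coantisymm : δ ≫ (𝟙 (L ⊗ L) + (β_ L L).hom) = 0
  cojacobi :
    δ ≫ δ ▷ L ≫
      (𝟙 ((L ⊗ L) ⊗ L) + swap23 L L L ≫ swap12 L L L + swap12 L L L ≫ swap23 L L L) = 0

/-- The morphism
`(([,] ⊗ id)(id ⊗ δ) + (id ⊗ [,])(C ⊗ id)(id ⊗ δ)) (id ⊗ id - C)`. -/
def cocycle {L : C} (br : L ⊗ L ⟶ L) (δ : L ⟶ L ⊗ L) : L ⊗ L ⟶ L ⊗ L :=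
  (𝟙 (L ⊗ L) - (β_ L L).hom) ≫
    (L ◁ δ ≫ (α_ L L L).inv ≫ br ▷ L +
      L ◁ δ ≫ (α_ L L L).inv ≫ swap12 L L L ≫ (α_ L L L).hom ≫ L ◁ br)

/-- Braided Lie bialgebras `(L, [,], δ)`. -/
structure IsBraidedLieBialgebra (L : C) (br : L ⊗ L ⟶ L) (δ : L ⟶ L ⊗ L) : Prop where
  lieAlgebra : IsBraidedLieAlgebra L br
  lieCoalgebra : IsBraidedLieCoalgebra L δ
  compat : br ≫ δ = cocycle br δ

/-- `(H, β)` is a right module over the braided Lie algebra `(A, [,])`: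
`β(id ⊗ [,]) = β(β ⊗ id) - β(β ⊗ id)(id ⊗ C_{A,A})`. -/
def IsRightModule {A H : C} (brA : A ⊗ A ⟶ A) (β : H ⊗ A ⟶ H) : Prop :=
  (α_ H A A).hom ≫ H ◁ brA ≫ β = β ▷ A ≫ β - swap23 H A A ≫ β ▷ A ≫ β

/-- `(H, ψ)` is a right comodule over the braided Lie coalgebra `(A, δ)`:
`(id ⊗ δ)ψ = (ψ ⊗ id)ψ - (id ⊗ C_{A,A})(ψ ⊗ id)ψ`. -/
def IsRightComodule {A H : C} (δA : A ⟶ A ⊗ A) (ψ : H ⟶ H ⊗ A) : Prop :=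
  ψ ≫ H ◁ δA ≫ (α_ H A A).inv = ψ ≫ ψ ▷ A - ψ ≫ ψ ▷ A ≫ swap23 H A A

/-- Right-right Yetter-Drinfeld modules `(H, β, ψ)` over `(A, [,], δ)`. -/
structure IsRightYetterDrinfeld {A H : C} (brA : A ⊗ A ⟶ A) (δA : A ⟶ A ⊗ A)
    (β : H ⊗ A ⟶ H) (ψ : H ⟶ H ⊗ A) : Prop where
  isModule : IsRightModule brA β
  isComodule : IsRightComodule δA ψ
  compat : β ≫ ψ =
    ψ ▷ A ≫ (α_ H A A).hom ≫ H ◁ brA +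
      ψ ▷ A ≫ swap23 H A A ≫ β ▷ A +
      H ◁ δA ≫ (α_ H A A).inv ≫ β ▷ A

/-- The action of `A` on `X ⊗ Y`: in elements, `(x ⊗ y)·a = x ⊗ y·a + x·a ⊗ y`. -/
def tensorAction {A X Y : C} (βX : X ⊗ A ⟶ X) (βY : Y ⊗ A ⟶ Y) : (X ⊗ Y) ⊗ A ⟶ X ⊗ Y :=
  (α_ X Y A).hom ≫ X ◁ βY + swap23 X Y A ≫ βX ▷ Y

/-- The coaction of `A` on `X ⊗ Y`. -/
def tensorCoaction {A X Y : C} (ψX : X ⟶ X ⊗ A) (ψY : Y ⟶ Y ⊗ A) : X ⊗ Y ⟶ (X ⊗ Y) ⊗ A :=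
  X ◁ ψY ≫ (α_ X Y A).inv + ψX ▷ Y ≫ swap23 X A Y

/-- `f` commutes with the right actions of `A`. -/
def IsModuleHom {A X Y : C} (βX : X ⊗ A ⟶ X) (βY : Y ⊗ A ⟶ Y) (f : X ⟶ Y) : Prop :=
  f ▷ A ≫ βY = βX ≫ f

/-- `f` commutes with the right coactions of `A`. -/
def IsComoduleHom {A X Y : C} (ψX : X ⟶ X ⊗ A) (ψY : Y ⟶ Y ⊗ A) (f : X ⟶ Y) : Prop :=
  f ≫ ψY = ψX ≫ f ▷ A

/-- The (right) infinitesimal braiding of `H`. With `ψ(x) = x₀ ⊗ x₁` and `β(x ⊗ a) = x·a` it is,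
up to the braidings that reorder the factors,
`x ⊗ y ↦ x₀ ⊗ y·x₁ + x·y₁ ⊗ y₀ - y₀ ⊗ x·y₁ - y·x₁ ⊗ x₀`. -/
def infinitesimalBraiding {A H : C} (β : H ⊗ A ⟶ H) (ψ : H ⟶ H ⊗ A) : H ⊗ H ⟶ H ⊗ H :=
  ψ ▷ H ≫ swap23 H A H ≫ (α_ H H A).hom ≫ H ◁ β +
    H ◁ ψ ≫ (α_ H H A).inv ≫ swap23 H H A ≫ β ▷ H -
    H ◁ ψ ≫ (α_ H H A).inv ≫ swap12 H H A ≫ (α_ H H A).hom ≫ H ◁ β -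
    ψ ▷ H ≫ swap23 H A H ≫ swap12 H H A ≫ swap23 H H A ≫ β ▷ H

/-- `(H, [,], δ, β, ψ)` is a right `A`-infinitesimal braided Lie bialgebra. -/
structure IsRightInfinitesimalBraidedLieBialgebra {A H : C}
    (brA : A ⊗ A ⟶ A) (δA : A ⟶ A ⊗ A) (brH : H ⊗ H ⟶ H) (δH : H ⟶ H ⊗ H)
    (β : H ⊗ A ⟶ H) (ψ : H ⟶ H ⊗ A) : Prop where
  lieAlgebra : IsBraidedLieAlgebra H brH
  lieCoalgebra : IsBraidedLieCoalgebra H δH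
  yetterDrinfeld : IsRightYetterDrinfeld brA δA β ψ
  bracket_moduleHom : IsModuleHom (tensorAction β β) β brH
  bracket_comoduleHom : IsComoduleHom (tensorCoaction ψ ψ) ψ brH
  cobracket_moduleHom : IsModuleHom β (tensorAction β β) δH
  cobracket_comoduleHom : IsComoduleHom ψ (tensorCoaction ψ ψ) δH
  compat : brH ≫ δH = cocycle brH δH - infinitesimalBraiding β ψ

end Basic

section Sum

open Limits

variable {C : Type u} [Category.{v} C] [MonoidalCategory C] [BraidedCategory C]
  [Preadditive C] [HasBinaryBiproducts C]

/-- The bracket of the double bicrosssum on `A ⊕ H`, for `α : H ⊗ A ⟶ A`, `β : H ⊗ A ⟶ H`. -/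
noncomputable def doubleBicrosssumBracket {A H : C} (brA : A ⊗ A ⟶ A) (brH : H ⊗ H ⟶ H)
    (α : H ⊗ A ⟶ A) (β : H ⊗ A ⟶ H) : (A ⊞ H) ⊗ (A ⊞ H) ⟶ A ⊞ H :=
  ((biprod.fst ⊗ₘ biprod.fst) ≫ brA +
      (biprod.snd ⊗ₘ biprod.fst) ≫ α -
      (biprod.fst ⊗ₘ biprod.snd) ≫ (β_ A H).hom ≫ α) ≫ biprod.inl +
    ((biprod.snd ⊗ₘ biprod.snd) ≫ brH +
      (biprod.snd ⊗ₘ biprod.fst) ≫ β -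
      (biprod.fst ⊗ₘ biprod.snd) ≫ (β_ A H).hom ≫ β) ≫ biprod.inr

/-- The cobracket of the double bicrosssum on `A ⊕ H`, for `φ : A ⟶ H ⊗ A`, `ψ : H ⟶ H ⊗ A`. -/
noncomputable def doubleBicrosssumCobracket {A H : C} (δA : A ⟶ A ⊗ A) (δH : H ⟶ H ⊗ H)
    (φ : A ⟶ H ⊗ A) (ψ : H ⟶ H ⊗ A) : A ⊞ H ⟶ (A ⊞ H) ⊗ (A ⊞ H) :=
  biprod.fst ≫
      (δA ≫ (biprod.inl ⊗ₘ biprod.inl) +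
        φ ≫ (biprod.inr ⊗ₘ biprod.inl) -
        φ ≫ (β_ H A).hom ≫ (biprod.inl ⊗ₘ biprod.inr)) +
    biprod.snd ≫
      (δH ≫ (biprod.inr ⊗ₘ biprod.inr) +
        ψ ≫ (biprod.inr ⊗ₘ biprod.inl) -
        ψ ≫ (β_ H A).hom ≫ (biprod.inl ⊗ₘ biprod.inr))

/-- The bracket of the bisum of `A` and `H` along `β` and `ψ`: the case `α = 0`. -/
noncomputable def bisumBracket {A H : C} (brA : A ⊗ A ⟶ A) (brH : H ⊗ H ⟶ H)
    (β : H ⊗ A ⟶ H) : (A ⊞ H) ⊗ (A ⊞ H) ⟶ A ⊞ H :=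
  doubleBicrosssumBracket brA brH 0 β

/-- The cobracket of the bisum of `A` and `H` along `β` and `ψ`: the case `φ = 0`. -/
noncomputable def bisumCobracket {A H : C} (δA : A ⟶ A ⊗ A) (δH : H ⟶ H ⊗ H)
    (ψ : H ⟶ H ⊗ A) : A ⊞ H ⟶ (A ⊞ H) ⊗ (A ⊞ H) :=
  doubleBicrosssumCobracket δA δH 0 ψ

end Sum

end BraidedLie

/-! The bracket makes `A ⊞ H` a semidirect product: `A` is a subalgebra acting on the ideal `H` by
`β`. Dually, the cobracket is a semidirect coproduct built from `ψ`. Since `⊗` is bi-additive, every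
identity can be tested on summands, and symmetry of the braiding on `{A, H}` makes the braiding of
`A ⊞ H` an involution.

The cyclic sum is invariant under rotation, so up to rotation Jacobi has four components. `AAA` and
`HHH` are the given Jacobi identities, `HAA` is the module axiom, and `HHA` says that `brH` is a
module morphism. Co-Jacobi is dual, with the comodule axiom and the comodule morphism property of
`δH`.

For compatibility, coantisymmetry turns the cocycle into `(1 - C) ∘ leftCocycle ∘ (1 - C)`
(`cocycle_eq`), and the infinitesimal braiding factors in the same way. On `H ⊗ A` the condition
splits into Yetter–Drinfeld and `δH` being a module morphism, and `A ⊗ H` follows by antisymmetry.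
On `H ⊗ H`, acting by the `A`-leg of `ψ` produces exactly the infinitesimal braiding that corrects
the compatibility of `H`; the mixed part says that `brH` is a comodule morphism. -/

namespace BraidedLie

/-! ### Additivity of whiskering -/

section Preadditive

variable {C : Type u} [Category.{v} C] [MonoidalCategory C] [Preadditive C]
  [MonoidalPreadditive C]

theorem whiskerLeft_neg (X : C) {Y Z : C} (f : Y ⟶ Z) : X ◁ (-f) = -(X ◁ f) :=
  (tensorLeft X).map_neg (f := f)

theorem neg_whiskerRight {X Y : C} (f : X ⟶ Y) (Z : C) : (-f) ▷ Z = -(f ▷ Z) :=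
  (tensorRight Z).map_neg (f := f)

theorem whiskerLeft_sub (X : C) {Y Z : C} (f g : Y ⟶ Z) : X ◁ (f - g) = X ◁ f - X ◁ g :=
  (tensorLeft X).map_sub

theorem sub_whiskerRight {X Y : C} (f g : X ⟶ Y) (Z : C) : (f - g) ▷ Z = f ▷ Z - g ▷ Z :=
  (tensorRight Z).map_sub

end Preadditive

/-! ### Permutations of three tensor factors -/

section Rotation

variable {C : Type u} [Category.{v} C] [MonoidalCategory C] [BraidedCategory C]

theorem SymmetricOn.braiding_comp_self {E : Set C} (h : SymmetricOn E) {X Y : C}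
    (hX : X ∈ E) (hY : Y ∈ E) : (β_ X Y).hom ≫ (β_ Y X).hom = 𝟙 (X ⊗ Y) := by
  rw [h X hX Y hY, Iso.inv_hom_id]

theorem swap12_comp_swap12 {X Y : C} (h : (β_ X Y).hom ≫ (β_ Y X).hom = 𝟙 (X ⊗ Y)) (Z : C) :
    swap12 X Y Z ≫ swap12 Y X Z = 𝟙 _ := by
  simp [swap12, ← comp_whiskerRight, h]

theorem swap23_comp_swap23 (X : C) {Y Z : C} (h : (β_ Y Z).hom ≫ (β_ Z Y).hom = 𝟙 (Y ⊗ Z)) :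
    swap23 X Y Z ≫ swap23 X Z Y = 𝟙 _ := by
  simp [swap23, ← whiskerLeft_comp_assoc, h]

theorem swap12_naturality {X X' Y Y' Z Z' : C} (f : X ⟶ X') (g : Y ⟶ Y') (h : Z ⟶ Z') :
    ((f ⊗ₘ g) ⊗ₘ h) ≫ swap12 X' Y' Z' = swap12 X Y Z ≫ ((g ⊗ₘ f) ⊗ₘ h) := by
  simp only [swap12, ← tensorHom_id, tensorHom_comp_tensorHom, Category.comp_id, Category.id_comp,
    BraidedCategory.braiding_naturality]

theorem swap23_naturality {X X' Y Y' Z Z' : C} (f : X ⟶ X') (g : Y ⟶ Y') (h : Z ⟶ Z') :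
    ((f ⊗ₘ g) ⊗ₘ h) ≫ swap23 X' Y' Z' = swap23 X Y Z ≫ ((f ⊗ₘ h) ⊗ₘ g) := by
  simp only [swap23, Category.assoc, ← associator_inv_naturality, associator_naturality_assoc,
    ← id_tensorHom, tensorHom_comp_tensorHom_assoc, Category.comp_id, Category.id_comp,
    BraidedCategory.braiding_naturality]

/-- The Yang-Baxter equation. -/
theorem swap_yang_baxter (X Y Z : C) :
    swap23 X Y Z ≫ swap12 X Z Y ≫ swap23 Z X Y = swap12 X Y Z ≫ swap23 Y X Z ≫ swap12 Y Z X := by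
  have := BraidedCategory.yang_baxter X Y Z
  simp only [swap12, swap23, Category.assoc]
  rw [← cancel_mono (α_ Z Y X).hom, ← cancel_epi (α_ X Y Z).inv]
  simpa using this.symm

/-- `swap23` followed by `swap12` braids the last factor to the front. -/
theorem swap23_comp_swap12 (X Y Z : C) :
    swap23 X Y Z ≫ swap12 X Z Y = (β_ (X ⊗ Y) Z).hom ≫ (α_ Z X Y).inv := by
  simp [swap12, swap23, BraidedCategory.braiding_tensor_left_hom]

/-- `swap12` followed by `swap23` braids the first factor to the end. -/
theorem swap12_comp_swap23 (X Y Z : C) :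
    swap12 X Y Z ≫ swap23 Y X Z = (α_ X Y Z).hom ≫ (β_ X (Y ⊗ Z)).hom := by
  simp [swap12, swap23, BraidedCategory.braiding_tensor_right_hom]

variable [Preadditive C]

/-- The sum of the three cyclic permutations of `(X ⊗ X) ⊗ X`. -/
def cyclicSum (X : C) : (X ⊗ X) ⊗ X ⟶ (X ⊗ X) ⊗ X :=
  𝟙 ((X ⊗ X) ⊗ X) + swap23 X X X ≫ swap12 X X X + swap12 X X X ≫ swap23 X X X

/-- By Yang–Baxter and `C² = 1`, the rotation has order three, so composing with it only permutes
the three terms. -/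
theorem rotate_comp_cyclicSum {X : C} (h : (β_ X X).hom ≫ (β_ X X).hom = 𝟙 (X ⊗ X)) :
    (swap23 X X X ≫ swap12 X X X) ≫ cyclicSum X = cyclicSum X := by
  have h12 := swap12_comp_swap12 h X
  have h23 := swap23_comp_swap23 X h
  have h3 : swap23 X X X ≫ swap12 X X X ≫ swap23 X X X ≫ swap12 X X X =
      swap12 X X X ≫ swap23 X X X := by
    have := swap_yang_baxter X X X =≫ swap12 X X X
    simpa [h12] using this
  have h4 : swap23 X X X ≫ swap12 X X X ≫ swap12 X X X ≫ swap23 X X X = 𝟙 _ := by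
    rw [reassoc_of% h12, h23]
  simp only [cyclicSum, Preadditive.comp_add, Category.comp_id, Category.assoc, h3, h4]
  abel

/-- Composing with `cyclicSum` does not see a rotation of the three factors. -/
theorem rotate_comp_tensor_comp_cyclicSum {D : C}
    (h : (β_ D D).hom ≫ (β_ D D).hom = 𝟙 (D ⊗ D)) {X Y Z : C}
    (f : X ⟶ D) (g : Y ⟶ D) (k : Z ⟶ D) :
    ((f ⊗ₘ g) ⊗ₘ k) ≫ cyclicSum D =
      swap23 X Y Z ≫ swap12 X Z Y ≫ ((k ⊗ₘ f) ⊗ₘ g) ≫ cyclicSum D := by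
  conv_lhs => rw [← rotate_comp_cyclicSum h]
  rw [Category.assoc, reassoc_of% swap23_naturality, reassoc_of% swap12_naturality]

end Rotation

/-! ### The cocycle as an antisymmetrization -/

section Cocycle

variable {C : Type u} [Category.{v} C] [MonoidalCategory C] [BraidedCategory C] [Preadditive C]
  [MonoidalPreadditive C]

/-- The morphism `x ⊗ y ↦ [x, y₁] ⊗ y₂`. -/
def leftCocycle {L : C} (br : L ⊗ L ⟶ L) (δ : L ⟶ L ⊗ L) : L ⊗ L ⟶ L ⊗ L :=
  L ◁ δ ≫ (α_ L L L).inv ≫ br ▷ L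

/-- Substituting `δ = -Cδ` in the second term and moving `[,]` through the braiding by naturality
gives minus the braiding of the first term. -/
theorem cocycle_eq {L : C} (br : L ⊗ L ⟶ L) {δ : L ⟶ L ⊗ L}
    (h : δ ≫ (𝟙 (L ⊗ L) + (β_ L L).hom) = 0) :
    cocycle br δ =
      (𝟙 (L ⊗ L) - (β_ L L).hom) ≫ leftCocycle br δ ≫ (𝟙 (L ⊗ L) - (β_ L L).hom) := by
  have hδ : δ = - (δ ≫ (β_ L L).hom) := by
    rw [Preadditive.comp_add, Category.comp_id] at h
    exact eq_neg_of_add_eq_zero_left h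
  have key : L ◁ δ ≫ (α_ L L L).inv ≫ swap12 L L L ≫ (α_ L L L).hom ≫ L ◁ br =
      - (leftCocycle br δ ≫ (β_ L L).hom) := by
    have h1 : L ◁ (β_ L L).hom ≫ (α_ L L L).inv = (α_ L L L).inv ≫ swap23 L L L := by
      simp [swap23]
    have h2 : swap23 L L L ≫ swap12 L L L ≫ (α_ L L L).hom = (β_ (L ⊗ L) L).hom := by
      rw [← Category.assoc, swap23_comp_swap12, Category.assoc, Iso.inv_hom_id, Category.comp_id]
    conv_lhs => rw [hδ]
    rw [whiskerLeft_neg, Preadditive.neg_comp, whiskerLeft_comp_assoc, reassoc_of% h1,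
      reassoc_of% h2, ← BraidedCategory.braiding_naturality_left, leftCocycle]
    simp only [Category.assoc]
  rw [cocycle, key, leftCocycle]
  simp [sub_eq_add_neg]

end Cocycle

/-! ### Testing morphisms on summands -/

section Biproduct

open Limits

variable {C : Type u} [Category.{v} C] [Preadditive C] [HasBinaryBiproducts C]

/-- An additive functor preserves the decomposition of the identity. Allowing any such functor lets
composites of tensoring functors reach each factor of a tensor power. -/
theorem map_biprod_hom_ext (F : C ⥤ C) [F.Additive] {A H T : C} {f g : F.obj (A ⊞ H) ⟶ T}
    (hA : F.map biprod.inl ≫ f = F.map biprod.inl ≫ g)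
    (hH : F.map biprod.inr ≫ f = F.map biprod.inr ≫ g) : f = g := by
  rw [← Category.id_comp f, ← Category.id_comp g, ← F.map_id, ← biprod.total, F.map_add,
    F.map_comp, F.map_comp]
  simp only [Preadditive.add_comp, Category.assoc, hA, hH]

variable [MonoidalCategory C] [MonoidalPreadditive C]

/-- Morphisms out of `(A ⊞ H) ⊗ (A ⊞ H)` are determined on the four summands. -/
theorem biprod_tensor_biprod_hom_ext {A H T : C} {f g : (A ⊞ H) ⊗ (A ⊞ H) ⟶ T}
    (hAA : ((biprod.inl : A ⟶ A ⊞ H) ⊗ₘ (biprod.inl : A ⟶ A ⊞ H)) ≫ f =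
      (biprod.inl ⊗ₘ biprod.inl) ≫ g)
    (hAH : ((biprod.inl : A ⟶ A ⊞ H) ⊗ₘ (biprod.inr : H ⟶ A ⊞ H)) ≫ f =
      (biprod.inl ⊗ₘ biprod.inr) ≫ g)
    (hHA : ((biprod.inr : H ⟶ A ⊞ H) ⊗ₘ (biprod.inl : A ⟶ A ⊞ H)) ≫ f =
      (biprod.inr ⊗ₘ biprod.inl) ≫ g)
    (hHH : ((biprod.inr : H ⟶ A ⊞ H) ⊗ₘ (biprod.inr : H ⟶ A ⊞ H)) ≫ f =
      (biprod.inr ⊗ₘ biprod.inr) ≫ g) : f = g := by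
  apply map_biprod_hom_ext (tensorRight (A ⊞ H)) <;> apply map_biprod_hom_ext (tensorLeft _) <;>
    simpa [← tensorHom_def'_assoc]

/-- Morphisms out of `((A ⊞ H) ⊗ (A ⊞ H)) ⊗ (A ⊞ H)` are determined on the eight summands. -/
theorem biprod_tensor_three_hom_ext {A H T : C}
    {f g : ((A ⊞ H) ⊗ (A ⊞ H)) ⊗ (A ⊞ H) ⟶ T}
    (hAAA : (((biprod.inl : A ⟶ A ⊞ H) ⊗ₘ (biprod.inl : A ⟶ A ⊞ H)) ⊗ₘ
      (biprod.inl : A ⟶ A ⊞ H)) ≫ f = ((biprod.inl ⊗ₘ biprod.inl) ⊗ₘ biprod.inl) ≫ g)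
    (hAAH : (((biprod.inl : A ⟶ A ⊞ H) ⊗ₘ (biprod.inl : A ⟶ A ⊞ H)) ⊗ₘ
      (biprod.inr : H ⟶ A ⊞ H)) ≫ f = ((biprod.inl ⊗ₘ biprod.inl) ⊗ₘ biprod.inr) ≫ g)
    (hAHA : (((biprod.inl : A ⟶ A ⊞ H) ⊗ₘ (biprod.inr : H ⟶ A ⊞ H)) ⊗ₘ
      (biprod.inl : A ⟶ A ⊞ H)) ≫ f = ((biprod.inl ⊗ₘ biprod.inr) ⊗ₘ biprod.inl) ≫ g)
    (hAHH : (((biprod.inl : A ⟶ A ⊞ H) ⊗ₘ (biprod.inr : H ⟶ A ⊞ H)) ⊗ₘ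
      (biprod.inr : H ⟶ A ⊞ H)) ≫ f = ((biprod.inl ⊗ₘ biprod.inr) ⊗ₘ biprod.inr) ≫ g)
    (hHAA : (((biprod.inr : H ⟶ A ⊞ H) ⊗ₘ (biprod.inl : A ⟶ A ⊞ H)) ⊗ₘ
      (biprod.inl : A ⟶ A ⊞ H)) ≫ f = ((biprod.inr ⊗ₘ biprod.inl) ⊗ₘ biprod.inl) ≫ g)
    (hHAH : (((biprod.inr : H ⟶ A ⊞ H) ⊗ₘ (biprod.inl : A ⟶ A ⊞ H)) ⊗ₘ
      (biprod.inr : H ⟶ A ⊞ H)) ≫ f = ((biprod.inr ⊗ₘ biprod.inl) ⊗ₘ biprod.inr) ≫ g)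
    (hHHA : (((biprod.inr : H ⟶ A ⊞ H) ⊗ₘ (biprod.inr : H ⟶ A ⊞ H)) ⊗ₘ
      (biprod.inl : A ⟶ A ⊞ H)) ≫ f = ((biprod.inr ⊗ₘ biprod.inr) ⊗ₘ biprod.inl) ≫ g)
    (hHHH : (((biprod.inr : H ⟶ A ⊞ H) ⊗ₘ (biprod.inr : H ⟶ A ⊞ H)) ⊗ₘ
      (biprod.inr : H ⟶ A ⊞ H)) ≫ f = ((biprod.inr ⊗ₘ biprod.inr) ⊗ₘ biprod.inr) ≫ g) :
    f = g := by
  apply map_biprod_hom_ext (tensorRight (A ⊞ H) ⋙ tensorRight (A ⊞ H)) <;>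
    apply map_biprod_hom_ext (tensorLeft _ ⋙ tensorRight (A ⊞ H)) <;>
    apply map_biprod_hom_ext (tensorLeft _) <;>
    simp only [tensorHom_def', comp_whiskerRight, Category.assoc] at * <;>
    assumption

end Biproduct

/-! ### Bracket, cobracket and braiding on the summands -/

section Bisum

open Limits

variable {C : Type u} [Category.{v} C] [Preadditive C] [HasBinaryBiproducts C]
  [MonoidalCategory C] [MonoidalPreadditive C] [BraidedCategory C] {A H : C}

theorem biprod_braiding_comp_self (hsymm : SymmetricOn ({A, H} : Set C)) :
    (β_ (A ⊞ H) (A ⊞ H)).hom ≫ (β_ (A ⊞ H) (A ⊞ H)).hom = 𝟙 _ := by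
  have key {X Y : C} (hX : X ∈ ({A, H} : Set C)) (hY : Y ∈ ({A, H} : Set C))
      (x : X ⟶ A ⊞ H) (y : Y ⟶ A ⊞ H) :
      (x ⊗ₘ y) ≫ (β_ (A ⊞ H) (A ⊞ H)).hom ≫ (β_ (A ⊞ H) (A ⊞ H)).hom = (x ⊗ₘ y) ≫ 𝟙 _ := by
    rw [BraidedCategory.braiding_naturality_assoc, BraidedCategory.braiding_naturality,
      ← Category.assoc, hsymm.braiding_comp_self hX hY, Category.comp_id, Category.id_comp]
  apply biprod_tensor_biprod_hom_ext <;> apply key <;> simp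

section Bracket

variable (brA : A ⊗ A ⟶ A) (brH : H ⊗ H ⟶ H) (β : H ⊗ A ⟶ H)

theorem inl_inl_bisumBracket :
    (biprod.inl ⊗ₘ biprod.inl) ≫ bisumBracket brA brH β = brA ≫ biprod.inl := by
  simp [bisumBracket, doubleBicrosssumBracket]

theorem inr_inl_bisumBracket :
    (biprod.inr ⊗ₘ biprod.inl) ≫ bisumBracket brA brH β = β ≫ biprod.inr := by
  simp [bisumBracket, doubleBicrosssumBracket]

theorem inl_inr_bisumBracket :
    (biprod.inl ⊗ₘ biprod.inr) ≫ bisumBracket brA brH β =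
      -((β_ A H).hom ≫ β ≫ biprod.inr) := by
  simp [bisumBracket, doubleBicrosssumBracket]

theorem inr_inr_bisumBracket :
    (biprod.inr ⊗ₘ biprod.inr) ≫ bisumBracket brA brH β = brH ≫ biprod.inr := by
  simp [bisumBracket, doubleBicrosssumBracket]

end Bracket

section Cobracket

variable (δA : A ⟶ A ⊗ A) (δH : H ⟶ H ⊗ H) (ψ : H ⟶ H ⊗ A)

omit [MonoidalPreadditive C] in
theorem inl_bisumCobracket :
    biprod.inl ≫ bisumCobracket δA δH ψ = δA ≫ (biprod.inl ⊗ₘ biprod.inl) := by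
  simp [bisumCobracket, doubleBicrosssumCobracket]

omit [MonoidalPreadditive C] in
theorem inr_bisumCobracket :
    biprod.inr ≫ bisumCobracket δA δH ψ =
      δH ≫ (biprod.inr ⊗ₘ biprod.inr) + ψ ≫ (biprod.inr ⊗ₘ biprod.inl) -
        ψ ≫ (β_ H A).hom ≫ (biprod.inl ⊗ₘ biprod.inr) := by
  simp [bisumCobracket, doubleBicrosssumCobracket]

end Cobracket

end Bisum

/-! ### Cyclic sums restricted to summands -/

section CyclicSum

variable {C : Type u} [Category.{v} C] [MonoidalCategory C] [BraidedCategory C] [Preadditive C]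

theorem tensor_comp_cyclicSum {D X Y Z : C} (f : X ⟶ D) (g : Y ⟶ D) (k : Z ⟶ D) :
    ((f ⊗ₘ g) ⊗ₘ k) ≫ cyclicSum D = ((f ⊗ₘ g) ⊗ₘ k) +
      swap23 X Y Z ≫ swap12 X Z Y ≫ ((k ⊗ₘ f) ⊗ₘ g) +
      swap12 X Y Z ≫ swap23 Y X Z ≫ ((g ⊗ₘ k) ⊗ₘ f) := by
  simp only [cyclicSum, Preadditive.comp_add, Category.comp_id, reassoc_of% swap23_naturality,
    swap12_naturality, reassoc_of% swap12_naturality, swap23_naturality]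

theorem tensor_self_comp_cyclicSum {D X : C} (f : X ⟶ D) :
    ((f ⊗ₘ f) ⊗ₘ f) ≫ cyclicSum D = cyclicSum X ≫ ((f ⊗ₘ f) ⊗ₘ f) := by
  rw [tensor_comp_cyclicSum]
  simp only [cyclicSum, Preadditive.add_comp, Category.id_comp, Category.assoc]

omit [BraidedCategory C] [Preadditive C] in
theorem tensor_comp_whiskerRight {W D E X Z : C} {w : W ⟶ D} {b : D ⟶ E} {m : W ⟶ X} {i : X ⟶ E}
    (h : w ≫ b = m ≫ i) {Z' : C} (k : Z ⟶ Z') :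
    (w ⊗ₘ k) ≫ b ▷ Z' = m ▷ Z ≫ (i ⊗ₘ k) := by
  rw [← tensorHom_id, tensorHom_comp_tensorHom, h, ← tensorHom_id, tensorHom_comp_tensorHom,
    Category.comp_id, Category.id_comp]

end CyclicSum

/-! ### Antisymmetry and Jacobi, with coantisymmetry -/

section Bisum

open Limits

variable {C : Type u} [Category.{v} C] [Preadditive C] [HasBinaryBiproducts C]
  [MonoidalCategory C] [MonoidalPreadditive C] [BraidedCategory C] {A H : C}

theorem bisumBracket_antisymm (hsymm : SymmetricOn ({A, H} : Set C)) {brA : A ⊗ A ⟶ A}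
    {brH : H ⊗ H ⟶ H} (β : H ⊗ A ⟶ H)
    (hA : (𝟙 (A ⊗ A) + (β_ A A).hom) ≫ brA = 0) (hH : (𝟙 (H ⊗ H) + (β_ H H).hom) ≫ brH = 0) :
    (𝟙 ((A ⊞ H) ⊗ (A ⊞ H)) + (β_ (A ⊞ H) (A ⊞ H)).hom) ≫ bisumBracket brA brH β = 0 := by
  have hHA : (β_ H A).hom ≫ (β_ A H).hom = 𝟙 _ := hsymm.braiding_comp_self (by simp) (by simp)
  rw [Preadditive.add_comp, Category.id_comp] at hA hH
  apply biprod_tensor_biprod_hom_ext <;>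
    simp only [Preadditive.comp_add, Preadditive.add_comp, Category.id_comp, Limits.comp_zero,
      BraidedCategory.braiding_naturality_assoc, inl_inl_bisumBracket, inl_inr_bisumBracket,
      inr_inl_bisumBracket, inr_inr_bisumBracket, Preadditive.comp_neg, reassoc_of% hHA,
      add_neg_cancel, neg_add_cancel]
  · rw [← Category.assoc, ← Preadditive.add_comp, hA, zero_comp]
  · rw [← Category.assoc, ← Preadditive.add_comp, hH, zero_comp]

omit [MonoidalPreadditive C] in
theorem bisumCobracket_coantisymm (hsymm : SymmetricOn ({A, H} : Set C)) {δA : A ⟶ A ⊗ A}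
    {δH : H ⟶ H ⊗ H} (ψ : H ⟶ H ⊗ A)
    (hA : δA ≫ (𝟙 (A ⊗ A) + (β_ A A).hom) = 0) (hH : δH ≫ (𝟙 (H ⊗ H) + (β_ H H).hom) = 0) :
    bisumCobracket δA δH ψ ≫ (𝟙 ((A ⊞ H) ⊗ (A ⊞ H)) + (β_ (A ⊞ H) (A ⊞ H)).hom) = 0 := by
  have hHA : (β_ H A).hom ≫ (β_ A H).hom = 𝟙 _ := hsymm.braiding_comp_self (by simp) (by simp)
  rw [Preadditive.comp_add, Category.comp_id] at hA hH
  apply biprod.hom_ext'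
  · rw [reassoc_of% inl_bisumCobracket, Preadditive.comp_add, Category.comp_id,
      BraidedCategory.braiding_naturality, Preadditive.comp_add, ← Category.assoc,
      ← Preadditive.add_comp, hA, zero_comp, comp_zero]
  · rw [reassoc_of% inr_bisumCobracket]
    simp only [Preadditive.comp_add, Category.comp_id, Preadditive.add_comp, Preadditive.sub_comp,
      Category.assoc, BraidedCategory.braiding_naturality, reassoc_of% hHA, comp_zero]
    have := hH =≫ ((biprod.inr : H ⟶ A ⊞ H) ⊗ₘ (biprod.inr : H ⟶ A ⊞ H))
    rw [Preadditive.add_comp, zero_comp, Category.assoc] at this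
    rw [← this]
    abel

theorem bisumBracket_jacobi (hsymm : SymmetricOn ({A, H} : Set C)) {brA : A ⊗ A ⟶ A}
    {brH : H ⊗ H ⟶ H} {β : H ⊗ A ⟶ H}
    (hA : cyclicSum A ≫ brA ▷ A ≫ brA = 0) (hH : cyclicSum H ≫ brH ▷ H ≫ brH = 0)
    (hbr : (𝟙 (H ⊗ H) + (β_ H H).hom) ≫ brH = 0)
    (hmod : IsRightModule brA β) (hhom : IsModuleHom (tensorAction β β) β brH) :
    cyclicSum (A ⊞ H) ≫ bisumBracket brA brH β ▷ (A ⊞ H) ≫ bisumBracket brA brH β = 0 := by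
  have hHA : (β_ H A).hom ≫ (β_ A H).hom = 𝟙 _ := hsymm.braiding_comp_self (by simp) (by simp)
  have hbr' : (β_ H H).hom ≫ brH = -brH := by
    rw [Preadditive.add_comp, Category.id_comp] at hbr
    exact eq_neg_of_add_eq_zero_right hbr
  have hAA := inl_inl_bisumBracket brA brH β
  have hHA' := inr_inl_bisumBracket brA brH β
  have hHH := inr_inr_bisumBracket brA brH β
  have hAH : (biprod.inl ⊗ₘ biprod.inr) ≫ bisumBracket brA brH β =
      (-((β_ A H).hom ≫ β)) ≫ biprod.inr := by
    rw [inl_inr_bisumBracket, Preadditive.neg_comp, Category.assoc]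
  -- Vanishing on one summand passes to its rotations, so one ordering of each type suffices.
  have hrot {X Y Z : C} (x : X ⟶ A ⊞ H) (y : Y ⟶ A ⊞ H) (z : Z ⟶ A ⊞ H)
      (h : ((z ⊗ₘ x) ⊗ₘ y) ≫ cyclicSum (A ⊞ H) ≫ bisumBracket brA brH β ▷ (A ⊞ H) ≫
        bisumBracket brA brH β = 0) :
      ((x ⊗ₘ y) ⊗ₘ z) ≫ cyclicSum (A ⊞ H) ≫ bisumBracket brA brH β ▷ (A ⊞ H) ≫
        bisumBracket brA brH β = 0 := by
    have := rotate_comp_tensor_comp_cyclicSum (biprod_braiding_comp_self hsymm) x y z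
    rw [reassoc_of% this, h, comp_zero, comp_zero]
  have hAAA : (((biprod.inl : A ⟶ A ⊞ H) ⊗ₘ (biprod.inl : A ⟶ A ⊞ H)) ⊗ₘ
      (biprod.inl : A ⟶ A ⊞ H)) ≫ cyclicSum (A ⊞ H) ≫ bisumBracket brA brH β ▷ (A ⊞ H) ≫
        bisumBracket brA brH β = 0 := by
    have := tensor_self_comp_cyclicSum (biprod.inl : A ⟶ A ⊞ H)
    rw [reassoc_of% this, reassoc_of% tensor_comp_whiskerRight hAA, hAA, reassoc_of% hA, zero_comp]
  have hHHH : (((biprod.inr : H ⟶ A ⊞ H) ⊗ₘ (biprod.inr : H ⟶ A ⊞ H)) ⊗ₘ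
      (biprod.inr : H ⟶ A ⊞ H)) ≫ cyclicSum (A ⊞ H) ≫ bisumBracket brA brH β ▷ (A ⊞ H) ≫
        bisumBracket brA brH β = 0 := by
    have := tensor_self_comp_cyclicSum (biprod.inr : H ⟶ A ⊞ H)
    rw [reassoc_of% this, reassoc_of% tensor_comp_whiskerRight hHH, hHH, reassoc_of% hH, zero_comp]
  have hHAA : (((biprod.inr : H ⟶ A ⊞ H) ⊗ₘ (biprod.inl : A ⟶ A ⊞ H)) ⊗ₘ
      (biprod.inl : A ⟶ A ⊞ H)) ≫ cyclicSum (A ⊞ H) ≫ bisumBracket brA brH β ▷ (A ⊞ H) ≫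
        bisumBracket brA brH β = 0 := by
    have h1 : swap12 H A A ≫ (β_ A H).hom ▷ A = 𝟙 _ := swap12_comp_swap12 hHA A
    have h2 : swap12 H A A ≫ swap23 A H A ≫ brA ▷ H ≫ (β_ A H).hom =
        (α_ H A A).hom ≫ H ◁ brA := by
      rw [← Category.assoc, swap12_comp_swap23, Category.assoc,
        ← BraidedCategory.braiding_naturality_right_assoc, hHA, Category.comp_id]
    rw [← Category.assoc, tensor_comp_cyclicSum]
    simp only [Preadditive.add_comp, Category.assoc,
      reassoc_of% tensor_comp_whiskerRight hHA', reassoc_of% tensor_comp_whiskerRight hAH,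
      reassoc_of% tensor_comp_whiskerRight hAA, hHA', hAH, neg_whiskerRight, comp_whiskerRight,
      Preadditive.neg_comp, Preadditive.comp_neg, reassoc_of% h1, reassoc_of% h2]
    -- The three cyclic terms are now, up to sign, the three terms of the module axiom.
    rw [IsRightModule] at hmod
    rw [reassoc_of% hmod]
    simp only [Preadditive.sub_comp, Category.assoc]
    abel
  have hHHA : (((biprod.inr : H ⟶ A ⊞ H) ⊗ₘ (biprod.inr : H ⟶ A ⊞ H)) ⊗ₘ
      (biprod.inl : A ⟶ A ⊞ H)) ≫ cyclicSum (A ⊞ H) ≫ bisumBracket brA brH β ▷ (A ⊞ H) ≫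
        bisumBracket brA brH β = 0 := by
    have h1 : swap12 H A H ≫ (β_ A H).hom ▷ H = 𝟙 _ := swap12_comp_swap12 hHA H
    -- Antisymmetry of `brH` turns `[y·a, x]` into `-[x, y·a]`, the form in the derivation rule for
    -- the action.
    have h2 : swap12 H H A ≫ swap23 H H A ≫ β ▷ H ≫ brH =
        -((α_ H H A).hom ≫ H ◁ β ≫ brH) := by
      rw [← Category.assoc, swap12_comp_swap23, Category.assoc,
        ← BraidedCategory.braiding_naturality_right_assoc, hbr']
      simp only [Preadditive.comp_neg]
    rw [← Category.assoc, tensor_comp_cyclicSum]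
    simp only [Preadditive.add_comp, Category.assoc,
      reassoc_of% tensor_comp_whiskerRight hHA', reassoc_of% tensor_comp_whiskerRight hAH,
      reassoc_of% tensor_comp_whiskerRight hHH, hHA', hHH, neg_whiskerRight, comp_whiskerRight,
      Preadditive.neg_comp, Preadditive.comp_neg, reassoc_of% h1, reassoc_of% h2]
    rw [IsModuleHom, tensorAction] at hhom
    rw [reassoc_of% hhom]
    simp only [Preadditive.add_comp, Category.assoc]
    abel
  apply biprod_tensor_three_hom_ext <;> rw [comp_zero]
  · exact hAAA
  · exact hrot _ _ _ hHAA
  · exact hrot _ _ _ (hrot _ _ _ hHAA)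
  · exact hrot _ _ _ (hrot _ _ _ hHHA)
  · exact hHAA
  · exact hrot _ _ _ hHHA
  · exact hHHA
  · exact hHHH

end Bisum

section CyclicSum

variable {C : Type u} [Category.{v} C] [MonoidalCategory C] [BraidedCategory C] [Preadditive C]

theorem rotate_inv_comp_cyclicSum {X : C} (h : (β_ X X).hom ≫ (β_ X X).hom = 𝟙 (X ⊗ X)) :
    (swap12 X X X ≫ swap23 X X X) ≫ cyclicSum X = cyclicSum X := by
  conv_lhs => rw [← rotate_comp_cyclicSum h]
  have h12 := swap12_comp_swap12 h X
  have h23 := swap23_comp_swap23 X h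
  simp only [Category.assoc, reassoc_of% h23, reassoc_of% h12]

/-- Composing with `cyclicSum` does not see an inverse rotation of the three factors. -/
theorem rotate_inv_comp_tensor_comp_cyclicSum {D : C}
    (h : (β_ D D).hom ≫ (β_ D D).hom = 𝟙 (D ⊗ D)) {X Y Z : C}
    (f : X ⟶ D) (g : Y ⟶ D) (k : Z ⟶ D) :
    ((f ⊗ₘ g) ⊗ₘ k) ≫ cyclicSum D =
      swap12 X Y Z ≫ swap23 Y X Z ≫ ((g ⊗ₘ k) ⊗ₘ f) ≫ cyclicSum D := by
  conv_lhs => rw [← rotate_inv_comp_cyclicSum h]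
  rw [Category.assoc, reassoc_of% swap12_naturality, reassoc_of% swap23_naturality]

end CyclicSum

/-! ### Co-Jacobi -/

section Bisum

open Limits

variable {C : Type u} [Category.{v} C] [Preadditive C] [HasBinaryBiproducts C]
  [MonoidalCategory C] [MonoidalPreadditive C] [BraidedCategory C] {A H : C}

omit [MonoidalPreadditive C] in
theorem inl_tensor_bisumCobracket_whiskerRight (δA : A ⟶ A ⊗ A) (δH : H ⟶ H ⊗ H)
    (ψ : H ⟶ H ⊗ A) {Z Z' : C} (k : Z ⟶ Z') :
    (biprod.inl ⊗ₘ k) ≫ bisumCobracket δA δH ψ ▷ Z' =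
      δA ▷ Z ≫ ((biprod.inl ⊗ₘ biprod.inl) ⊗ₘ k) :=
  tensor_comp_whiskerRight (inl_bisumCobracket δA δH ψ) k

theorem inr_tensor_bisumCobracket_whiskerRight (δA : A ⟶ A ⊗ A) (δH : H ⟶ H ⊗ H)
    (ψ : H ⟶ H ⊗ A) {Z Z' : C} (k : Z ⟶ Z') :
    (biprod.inr ⊗ₘ k) ≫ bisumCobracket δA δH ψ ▷ Z' =
      δH ▷ Z ≫ ((biprod.inr ⊗ₘ biprod.inr) ⊗ₘ k) + ψ ▷ Z ≫ ((biprod.inr ⊗ₘ biprod.inl) ⊗ₘ k) -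
        ψ ▷ Z ≫ (β_ H A).hom ▷ Z ≫ ((biprod.inl ⊗ₘ biprod.inr) ⊗ₘ k) := by
  rw [tensorHom_def', Category.assoc, ← comp_whiskerRight, inr_bisumCobracket]
  simp only [MonoidalPreadditive.add_whiskerRight, sub_whiskerRight, comp_whiskerRight,
    Preadditive.comp_add, Preadditive.comp_sub, tensorHom_def (_ ⊗ₘ _) k, whisker_exchange,
    whisker_exchange_assoc]

theorem bisumCobracket_cojacobi (hsymm : SymmetricOn ({A, H} : Set C)) {δA : A ⟶ A ⊗ A}
    {δH : H ⟶ H ⊗ H} {ψ : H ⟶ H ⊗ A}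
    (hA : δA ≫ δA ▷ A ≫ cyclicSum A = 0) (hH : δH ≫ δH ▷ H ≫ cyclicSum H = 0)
    (hδ : δH ≫ (𝟙 (H ⊗ H) + (β_ H H).hom) = 0)
    (hcomod : IsRightComodule δA ψ) (hhom : IsComoduleHom ψ (tensorCoaction ψ ψ) δH) :
    bisumCobracket δA δH ψ ≫ bisumCobracket δA δH ψ ▷ (A ⊞ H) ≫ cyclicSum (A ⊞ H) = 0 := by
  have hHA : (β_ H A).hom ≫ (β_ A H).hom = 𝟙 _ := hsymm.braiding_comp_self (by simp) (by simp)
  have hδ' : δH ≫ (β_ H H).hom = -δH := by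
    rw [Preadditive.comp_add, Category.comp_id] at hδ
    exact eq_neg_of_add_eq_zero_right hδ
  have hD := biprod_braiding_comp_self hsymm
  apply biprod.hom_ext'
  · rw [reassoc_of% inl_bisumCobracket, ← Category.assoc (_ ⊗ₘ _),
      inl_tensor_bisumCobracket_whiskerRight, Category.assoc, tensor_self_comp_cyclicSum,
      reassoc_of% hA, zero_comp, comp_zero]
  · have hHHH : ((((biprod.inr : H ⟶ A ⊞ H) ⊗ₘ (biprod.inr : H ⟶ A ⊞ H)) ⊗ₘ
        (biprod.inr : H ⟶ A ⊞ H))) ≫ cyclicSum (A ⊞ H) = _ := tensor_self_comp_cyclicSum _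
    -- Every mixed term is rotated into the order `HHA` or `HAA`, so that like terms can be
    -- compared.
    have hHAH := rotate_comp_tensor_comp_cyclicSum hD (biprod.inr : H ⟶ A ⊞ H)
      (biprod.inl : A ⟶ A ⊞ H) (biprod.inr : H ⟶ A ⊞ H)
    have hAAH := rotate_comp_tensor_comp_cyclicSum hD (biprod.inl : A ⟶ A ⊞ H)
      (biprod.inl : A ⟶ A ⊞ H) (biprod.inr : H ⟶ A ⊞ H)
    have hAHH := rotate_inv_comp_tensor_comp_cyclicSum hD (biprod.inl : A ⟶ A ⊞ H)
      (biprod.inr : H ⟶ A ⊞ H) (biprod.inr : H ⟶ A ⊞ H)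
    have hAHA := rotate_inv_comp_tensor_comp_cyclicSum hD (biprod.inl : A ⟶ A ⊞ H)
      (biprod.inr : H ⟶ A ⊞ H) (biprod.inl : A ⟶ A ⊞ H)
    have h1 (Z : C) : (β_ H A).hom ▷ Z ≫ swap12 A H Z = 𝟙 _ := swap12_comp_swap12 hHA Z
    have h2 : δH ≫ ψ ▷ H ≫ swap23 H A H ≫ swap12 H H A = -(δH ≫ H ◁ ψ ≫ (α_ H H A).inv) := by
      rw [swap23_comp_swap12, BraidedCategory.braiding_naturality_left_assoc, reassoc_of% hδ',
        Preadditive.neg_comp]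
    have h3 : (β_ H A).hom ≫ δA ▷ H ≫ swap23 A A H ≫ swap12 A H A =
        H ◁ δA ≫ (α_ H A A).inv := by
      rw [swap23_comp_swap12, BraidedCategory.braiding_naturality_left_assoc, reassoc_of% hHA]
    simp only [reassoc_of% inr_bisumCobracket, Preadditive.add_comp, Preadditive.sub_comp,
      Preadditive.comp_add, Preadditive.comp_sub, Category.assoc,
      reassoc_of% inl_tensor_bisumCobracket_whiskerRight δA δH ψ,
      reassoc_of% inr_tensor_bisumCobracket_whiskerRight δA δH ψ, hHHH, hHAH, hAAH, hAHH, hAHA,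
      reassoc_of% h1, reassoc_of% h2, reassoc_of% h3, reassoc_of% hH, zero_comp, comp_zero,
      Preadditive.neg_comp]
    rw [IsComoduleHom, tensorCoaction] at hhom
    rw [IsRightComodule] at hcomod
    rw [reassoc_of% hcomod, ← reassoc_of% hhom]
    simp only [Preadditive.add_comp, Preadditive.sub_comp, Preadditive.comp_add, Category.assoc]
    abel

end Bisum

/-! ### The infinitesimal braiding as an antisymmetrization -/

section InfinitesimalBraiding

variable {C : Type u} [Category.{v} C] [MonoidalCategory C] [BraidedCategory C] [Preadditive C]
  {A H : C}

/-- The morphism `x ⊗ y ↦ x·y₁ ⊗ y₀`. -/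
def leftInfinitesimalBraiding (β : H ⊗ A ⟶ H) (ψ : H ⟶ H ⊗ A) : H ⊗ H ⟶ H ⊗ H :=
  H ◁ ψ ≫ (α_ H H A).inv ≫ swap23 H H A ≫ β ▷ H

omit [Preadditive C] in
theorem whiskerRight_comp_braiding {X Y Z W : C} (f : X ⊗ Y ⟶ W) :
    f ▷ Z ≫ (β_ W Z).hom =
      swap23 X Y Z ≫ swap12 X Z Y ≫ (α_ Z X Y).hom ≫ Z ◁ f := by
  rw [BraidedCategory.braiding_naturality_left, ← Category.assoc (swap23 _ _ _),
    swap23_comp_swap12, Category.assoc, Iso.inv_hom_id_assoc]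

omit [Preadditive C] in
theorem braiding_comp_whiskerLeft {X Y Z W : C} (f : W ⟶ X ⊗ Y) :
    (β_ W Z).hom ≫ Z ◁ f ≫ (α_ Z X Y).inv = f ▷ Z ≫ swap23 X Y Z ≫ swap12 X Z Y := by
  rw [swap23_comp_swap12, BraidedCategory.braiding_naturality_left_assoc]

/-- Naturality carries the outer braidings past `ψ` and `β`; the involutive swaps then cancel,
leaving the four defining terms. -/
theorem infinitesimalBraiding_eq (hsymm : SymmetricOn ({A, H} : Set C)) (β : H ⊗ A ⟶ H)
    (ψ : H ⟶ H ⊗ A) :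
    infinitesimalBraiding β ψ = (𝟙 (H ⊗ H) - (β_ H H).hom) ≫
      leftInfinitesimalBraiding β ψ ≫ (𝟙 (H ⊗ H) - (β_ H H).hom) := by
  have hAH : swap23 H H A ≫ swap23 H A H = 𝟙 _ :=
    swap23_comp_swap23 H (hsymm.braiding_comp_self (by simp) (by simp))
  have hHH : swap12 H H A ≫ swap12 H H A = 𝟙 _ :=
    swap12_comp_swap12 (hsymm.braiding_comp_self (by simp) (by simp)) A
  have h1 := braiding_comp_whiskerLeft (Z := H) ψ
  have h2 := whiskerRight_comp_braiding (Z := H) β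
  simp only [leftInfinitesimalBraiding, infinitesimalBraiding, Preadditive.sub_comp,
    Preadditive.comp_sub, Category.id_comp, Category.comp_id, Category.assoc, reassoc_of% h1, h2,
    reassoc_of% hAH, reassoc_of% hHH]
  abel

end InfinitesimalBraiding

/-! ### Compatibility of bracket and cobracket -/

section Bisum

open Limits

variable {C : Type u} [Category.{v} C] [Preadditive C] [HasBinaryBiproducts C]
  [MonoidalCategory C] [MonoidalPreadditive C] [BraidedCategory C] {A H : C}

omit [MonoidalPreadditive C] in
theorem tensor_inl_whiskerLeft_bisumCobracket (δA : A ⟶ A ⊗ A) (δH : H ⟶ H ⊗ H)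
    (ψ : H ⟶ H ⊗ A) {X X' : C} (x : X ⟶ X') :
    (x ⊗ₘ biprod.inl) ≫ X' ◁ bisumCobracket δA δH ψ ≫ (α_ X' (A ⊞ H) (A ⊞ H)).inv =
      X ◁ δA ≫ (α_ X A A).inv ≫ ((x ⊗ₘ biprod.inl) ⊗ₘ biprod.inl) := by
  conv_lhs => rw [MonoidalCategory.tensorHom_def]
  rw [Category.assoc, ← whiskerLeft_comp_assoc, inl_bisumCobracket]
  simp only [← associator_inv_naturality, tensorHom_def' x (_ ⊗ₘ _), ← whisker_exchange_assoc,
    whiskerLeft_comp, Category.assoc]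

theorem tensor_inr_whiskerLeft_bisumCobracket (δA : A ⟶ A ⊗ A) (δH : H ⟶ H ⊗ H)
    (ψ : H ⟶ H ⊗ A) {X X' : C} (x : X ⟶ X') :
    (x ⊗ₘ biprod.inr) ≫ X' ◁ bisumCobracket δA δH ψ ≫ (α_ X' (A ⊞ H) (A ⊞ H)).inv =
      X ◁ δH ≫ (α_ X H H).inv ≫ ((x ⊗ₘ biprod.inr) ⊗ₘ biprod.inr) +
      X ◁ ψ ≫ (α_ X H A).inv ≫ ((x ⊗ₘ biprod.inr) ⊗ₘ biprod.inl) -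
      X ◁ ψ ≫ X ◁ (β_ H A).hom ≫ (α_ X A H).inv ≫ ((x ⊗ₘ biprod.inl) ⊗ₘ biprod.inr) := by
  conv_lhs => rw [MonoidalCategory.tensorHom_def]
  rw [Category.assoc, ← whiskerLeft_comp_assoc, inr_bisumCobracket]
  simp only [← associator_inv_naturality, tensorHom_def' x (_ ⊗ₘ _), ← whisker_exchange_assoc,
    MonoidalPreadditive.whiskerLeft_add, whiskerLeft_sub, whiskerLeft_comp, Preadditive.add_comp,
    Preadditive.sub_comp, Preadditive.comp_add, Preadditive.comp_sub, Category.assoc]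

variable (brA : A ⊗ A ⟶ A) (δA : A ⟶ A ⊗ A) (brH : H ⊗ H ⟶ H) (δH : H ⟶ H ⊗ H)
  (β : H ⊗ A ⟶ H) (ψ : H ⟶ H ⊗ A)

theorem inl_inl_leftCocycle :
    (biprod.inl ⊗ₘ biprod.inl) ≫
        leftCocycle (bisumBracket brA brH β) (bisumCobracket δA δH ψ) =
      leftCocycle brA δA ≫ (biprod.inl ⊗ₘ biprod.inl) := by
  rw [leftCocycle, leftCocycle, reassoc_of% tensor_inl_whiskerLeft_bisumCobracket δA δH ψ,
    tensor_comp_whiskerRight (inl_inl_bisumBracket brA brH β)]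
  simp only [Category.assoc]

theorem inr_inl_leftCocycle :
    (biprod.inr ⊗ₘ biprod.inl) ≫
        leftCocycle (bisumBracket brA brH β) (bisumCobracket δA δH ψ) =
      H ◁ δA ≫ (α_ H A A).inv ≫ β ▷ A ≫ (biprod.inr ⊗ₘ biprod.inl) := by
  rw [leftCocycle, reassoc_of% tensor_inl_whiskerLeft_bisumCobracket δA δH ψ,
    tensor_comp_whiskerRight (inr_inl_bisumBracket brA brH β)]

theorem inl_inr_leftCocycle :
    (biprod.inl ⊗ₘ biprod.inr) ≫
        leftCocycle (bisumBracket brA brH β) (bisumCobracket δA δH ψ) =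
      -(A ◁ δH ≫ (α_ A H H).inv ≫ (β_ A H).hom ▷ H ≫ β ▷ H ≫ (biprod.inr ⊗ₘ biprod.inr)) -
      A ◁ ψ ≫ (α_ A H A).inv ≫ (β_ A H).hom ▷ A ≫ β ▷ A ≫ (biprod.inr ⊗ₘ biprod.inl) -
      A ◁ ψ ≫ A ◁ (β_ H A).hom ≫ (α_ A A H).inv ≫ brA ▷ H ≫ (biprod.inl ⊗ₘ biprod.inr) := by
  have h : (biprod.inl ⊗ₘ biprod.inr) ≫ bisumBracket brA brH β =
      (-((β_ A H).hom ≫ β)) ≫ biprod.inr := by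
    rw [inl_inr_bisumBracket, Preadditive.neg_comp, Category.assoc]
  rw [leftCocycle, reassoc_of% tensor_inr_whiskerLeft_bisumCobracket δA δH ψ]
  simp only [Preadditive.add_comp, Preadditive.sub_comp, Category.assoc,
    tensor_comp_whiskerRight h, tensor_comp_whiskerRight (inl_inl_bisumBracket brA brH β),
    neg_whiskerRight, comp_whiskerRight, Preadditive.neg_comp, Preadditive.comp_neg]
  abel

/-- The `A ⊗ H` part of the cobracket carries a minus sign, and its `A`-leg acts through `β`; this
is the origin of the subtracted infinitesimal braiding. -/
theorem inr_inr_leftCocycle :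
    (biprod.inr ⊗ₘ biprod.inr) ≫
        leftCocycle (bisumBracket brA brH β) (bisumCobracket δA δH ψ) =
      (leftCocycle brH δH - leftInfinitesimalBraiding β ψ) ≫ (biprod.inr ⊗ₘ biprod.inr) +
      H ◁ ψ ≫ (α_ H H A).inv ≫ brH ▷ A ≫ (biprod.inr ⊗ₘ biprod.inl) := by
  rw [leftCocycle, reassoc_of% tensor_inr_whiskerLeft_bisumCobracket δA δH ψ]
  simp only [Preadditive.add_comp, Preadditive.sub_comp, Category.assoc, leftCocycle,
    leftInfinitesimalBraiding, swap23, Iso.inv_hom_id_assoc,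
    tensor_comp_whiskerRight (inr_inl_bisumBracket brA brH β),
    tensor_comp_whiskerRight (inr_inr_bisumBracket brA brH β)]
  abel

variable {brA δA brH δH β ψ}

theorem bisum_compat (hsymm : SymmetricOn ({A, H} : Set C))
    (hA : IsBraidedLieBialgebra A brA δA)
    (hH : IsRightInfinitesimalBraidedLieBialgebra brA δA brH δH β ψ) :
    bisumBracket brA brH β ≫ bisumCobracket δA δH ψ =
      cocycle (bisumBracket brA brH β) (bisumCobracket δA δH ψ) := by
  have hHA : (β_ H A).hom ≫ (β_ A H).hom = 𝟙 _ := hsymm.braiding_comp_self (by simp) (by simp)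
  have hAH : (β_ A H).hom ≫ (β_ H A).hom = 𝟙 _ := hsymm.braiding_comp_self (by simp) (by simp)
  have hbrA : (β_ A A).hom ≫ brA = -brA := by
    have := hA.lieAlgebra.antisymm
    rw [Preadditive.add_comp, Category.id_comp] at this
    exact eq_neg_of_add_eq_zero_right this
  have hbrH : (β_ H H).hom ≫ brH = -brH := by
    have := hH.lieAlgebra.antisymm
    rw [Preadditive.add_comp, Category.id_comp] at this
    exact eq_neg_of_add_eq_zero_right this
  have hδH : δH ≫ (β_ H H).hom = -δH := by
    have := hH.lieCoalgebra.coantisymm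
    rw [Preadditive.comp_add, Category.comp_id] at this
    exact eq_neg_of_add_eq_zero_right this
  rw [cocycle_eq _ (bisumCobracket_coantisymm hsymm ψ hA.lieCoalgebra.coantisymm
    hH.lieCoalgebra.coantisymm)]
  -- the component on `H ⊗ A`
  have key : ((biprod.inr : H ⟶ A ⊞ H) ⊗ₘ (biprod.inl : A ⟶ A ⊞ H)) ≫
      bisumBracket brA brH β ≫ bisumCobracket δA δH ψ =
      ((biprod.inr : H ⟶ A ⊞ H) ⊗ₘ (biprod.inl : A ⟶ A ⊞ H)) ≫
      (𝟙 ((A ⊞ H) ⊗ (A ⊞ H)) - (β_ (A ⊞ H) (A ⊞ H)).hom) ≫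
        leftCocycle (bisumBracket brA brH β) (bisumCobracket δA δH ψ) ≫
        (𝟙 ((A ⊞ H) ⊗ (A ⊞ H)) - (β_ (A ⊞ H) (A ⊞ H)).hom) := by
    have s1 (Z : C) : swap12 H A Z ≫ (β_ A H).hom ▷ Z = 𝟙 _ := swap12_comp_swap12 hHA Z
    have s2 : swap23 H H A ≫ swap23 H A H = 𝟙 _ := swap23_comp_swap23 H hHA
    have s3 : swap23 A H A ≫ swap23 A A H = 𝟙 _ := swap23_comp_swap23 A hHA
    have s4 : swap12 H A A ≫ swap12 A H A = 𝟙 _ := swap12_comp_swap12 hHA A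
    -- This recovers the term `x₀ ⊗ [x₁, a]` of the Yetter–Drinfeld condition; the sign comes from
    -- antisymmetry of `brA`.
    have e1 : (β_ H A).hom ≫ A ◁ ψ ≫ A ◁ (β_ H A).hom ≫ (α_ A A H).inv ≫ brA ▷ H ≫
        (β_ A H).hom = -(ψ ▷ A ≫ (α_ H A A).hom ≫ H ◁ brA) := by
      have e2 : A ◁ (β_ H A).hom ≫ (α_ A A H).inv = (α_ A H A).inv ≫ swap23 A H A := by
        simp [swap23]
      have e3 := braiding_comp_whiskerLeft (Z := A) ψ
      have e4 : swap23 H A A ≫ (α_ H A A).hom ≫ H ◁ brA = -((α_ H A A).hom ≫ H ◁ brA) := by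
        rw [swap23, Category.assoc, Category.assoc, Iso.inv_hom_id_assoc, ← whiskerLeft_comp, hbrA,
          whiskerLeft_neg, Preadditive.comp_neg]
      rw [reassoc_of% e2, reassoc_of% e3, whiskerRight_comp_braiding, reassoc_of% s3,
        reassoc_of% s4, e4, Preadditive.comp_neg]
    have e5 := braiding_comp_whiskerLeft (Z := A) ψ
    have e6 := braiding_comp_whiskerLeft (Z := A) δH
    have e7 : δH ▷ A ≫ swap12 H H A = -(δH ▷ A) := by
      rw [swap12, ← comp_whiskerRight, hδH, neg_whiskerRight]
    have hYD := hH.yetterDrinfeld.compat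
    have hδ := hH.cobracket_moduleHom
    rw [IsModuleHom, tensorAction] at hδ
    simp only [reassoc_of% inr_inl_bisumBracket, inr_bisumCobracket, Preadditive.comp_add,
      Preadditive.comp_sub, Preadditive.sub_comp, Preadditive.add_comp, Category.id_comp,
      Category.comp_id, Category.assoc, BraidedCategory.braiding_naturality_assoc,
      reassoc_of% inr_inl_leftCocycle, reassoc_of% inl_inr_leftCocycle, inr_inl_leftCocycle,
      inl_inr_leftCocycle, Preadditive.neg_comp, Preadditive.comp_neg,
      BraidedCategory.braiding_naturality, reassoc_of% e1, reassoc_of% e5, reassoc_of% e6,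
      reassoc_of% s1, reassoc_of% (whiskerRight_comp_braiding (Z := H) β), reassoc_of% s2,
      reassoc_of% e7, reassoc_of% hYD, ← reassoc_of% hδ]
    -- Expanding the outer `1 - C` also leaves this term without its final braiding; it is `e1` with
    -- that braiding undone.
    have e8 : (β_ H A).hom ≫ A ◁ ψ ≫ A ◁ (β_ H A).hom ≫ (α_ A A H).inv ≫ brA ▷ H =
      -(ψ ▷ A ≫ (α_ H A A).hom ≫ H ◁ brA ≫ (β_ H A).hom) := by
      have := e1 =≫ (β_ H A).hom
      simpa only [Category.assoc, hAH, Category.comp_id, Preadditive.neg_comp] using this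
    simp only [reassoc_of% e8, Preadditive.neg_comp, Category.assoc]
    abel
  apply biprod_tensor_biprod_hom_ext
  · have := hA.compat
    rw [cocycle_eq _ hA.lieCoalgebra.coantisymm] at this
    rw [reassoc_of% inl_inl_bisumBracket, inl_bisumCobracket, reassoc_of% this]
    simp only [Preadditive.comp_sub, Preadditive.sub_comp, Category.id_comp, Category.comp_id,
      BraidedCategory.braiding_naturality_assoc, inl_inl_leftCocycle,
      BraidedCategory.braiding_naturality, reassoc_of% inl_inl_leftCocycle]
  · have h1 : ((biprod.inl : A ⟶ A ⊞ H) ⊗ₘ (biprod.inr : H ⟶ A ⊞ H)) ≫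
        bisumBracket brA brH β = -((β_ A H).hom ≫
          ((biprod.inr : H ⟶ A ⊞ H) ⊗ₘ (biprod.inl : A ⟶ A ⊞ H)) ≫ bisumBracket brA brH β) := by
      rw [inl_inr_bisumBracket, inr_inl_bisumBracket]
    have h2 : ((biprod.inl : A ⟶ A ⊞ H) ⊗ₘ (biprod.inr : H ⟶ A ⊞ H)) ≫
        (𝟙 ((A ⊞ H) ⊗ (A ⊞ H)) - (β_ (A ⊞ H) (A ⊞ H)).hom) = -((β_ A H).hom ≫
          ((biprod.inr : H ⟶ A ⊞ H) ⊗ₘ (biprod.inl : A ⟶ A ⊞ H)) ≫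
          (𝟙 ((A ⊞ H) ⊗ (A ⊞ H)) - (β_ (A ⊞ H) (A ⊞ H)).hom)) := by
      simp only [Preadditive.comp_sub, Category.comp_id, BraidedCategory.braiding_naturality,
        reassoc_of% hAH]
      abel
    rw [reassoc_of% h1, reassoc_of% h2, Preadditive.neg_comp, Preadditive.neg_comp]
    simp only [Category.assoc, key]
  · exact key
  · have h1 : brH ≫ ψ = (𝟙 (H ⊗ H) - (β_ H H).hom) ≫ H ◁ ψ ≫ (α_ H H A).inv ≫ brH ▷ A := by
      have e1 := braiding_comp_whiskerLeft (Z := H) ψ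
      have e2 : swap12 H H A ≫ brH ▷ A = -(brH ▷ A) := by
        rw [swap12, ← comp_whiskerRight, hbrH, neg_whiskerRight]
      have := hH.bracket_comoduleHom
      rw [IsComoduleHom, tensorCoaction] at this
      simp only [this, Preadditive.sub_comp, Preadditive.add_comp, Category.id_comp,
        Category.assoc, reassoc_of% e1, e2, Preadditive.comp_neg]
      abel
    have h2 := hH.compat
    rw [cocycle_eq _ hH.lieCoalgebra.coantisymm, infinitesimalBraiding_eq hsymm,
      ← Preadditive.comp_sub, ← Preadditive.sub_comp] at h2
    have h3 : ((biprod.inr : H ⟶ A ⊞ H) ⊗ₘ (biprod.inr : H ⟶ A ⊞ H)) ≫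
        (𝟙 ((A ⊞ H) ⊗ (A ⊞ H)) - (β_ (A ⊞ H) (A ⊞ H)).hom) =
        (𝟙 (H ⊗ H) - (β_ H H).hom) ≫ (biprod.inr ⊗ₘ biprod.inr) := by
      simp only [Preadditive.comp_sub, Preadditive.sub_comp, Category.comp_id, Category.id_comp,
        BraidedCategory.braiding_naturality]
    rw [reassoc_of% h3, reassoc_of% inr_inr_leftCocycle brA δA brH δH β ψ, Preadditive.add_comp,
      Category.assoc, h3, reassoc_of% inr_inr_bisumBracket, inr_bisumCobracket]
    simp only [Category.assoc, Preadditive.comp_add, reassoc_of% h2, Preadditive.comp_sub,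
      reassoc_of% h1, Category.comp_id, BraidedCategory.braiding_naturality]
    abel

end Bisum

open Limits in
theorem isBraidedLieBialgebra_bisum {C : Type u} [Category.{v} C] [Preadditive C]
    [HasBinaryBiproducts C] [MonoidalCategory C] [MonoidalPreadditive C] [BraidedCategory C]
    {A H : C} (hsymm : SymmetricOn ({A, H} : Set C)) {brA : A ⊗ A ⟶ A} {δA : A ⟶ A ⊗ A}
    {brH : H ⊗ H ⟶ H} {δH : H ⟶ H ⊗ H} {β : H ⊗ A ⟶ H} {ψ : H ⟶ H ⊗ A}
    (hA : IsBraidedLieBialgebra A brA δA)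
    (hH : IsRightInfinitesimalBraidedLieBialgebra brA δA brH δH β ψ) :
    IsBraidedLieBialgebra (A ⊞ H) (bisumBracket brA brH β) (bisumCobracket δA δH ψ) := by
  have hD := biprod_braiding_comp_self hsymm
  have hS : SymmetricOn {A ⊞ H} := by
    rintro _ rfl _ rfl
    rw [← cancel_mono (β_ (A ⊞ H) (A ⊞ H)).hom, hD, Iso.inv_hom_id]
  exact {
    lieAlgebra := {
      symm := hS
      antisymm := bisumBracket_antisymm hsymm β hA.lieAlgebra.antisymm hH.lieAlgebra.antisymm
      jacobi := bisumBracket_jacobi hsymm hA.lieAlgebra.jacobi hH.lieAlgebra.jacobi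
        hH.lieAlgebra.antisymm hH.yetterDrinfeld.isModule hH.bracket_moduleHom }
    lieCoalgebra := {
      symm := hS
      coantisymm := bisumCobracket_coantisymm hsymm ψ hA.lieCoalgebra.coantisymm
        hH.lieCoalgebra.coantisymm
      cojacobi := bisumCobracket_cojacobi hsymm hA.lieCoalgebra.cojacobi hH.lieCoalgebra.cojacobi
        hH.lieCoalgebra.coantisymm hH.yetterDrinfeld.isComodule hH.cobracket_comoduleHom }
    compat := bisum_compat hsymm hA hH }

end BraidedLie

theorem corollary1p12 {C : Type u} [Category.{v} C] [Preadditive C]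
    [Limits.HasBinaryBiproducts C] [MonoidalCategory C] [MonoidalPreadditive C]
    [BraidedCategory C] {A H : C}
    (hsymm : BraidedLie.SymmetricOn ({A, H} : Set C))
    (brA : A ⊗ A ⟶ A) (δA : A ⟶ A ⊗ A)
    (brH : H ⊗ H ⟶ H) (δH : H ⟶ H ⊗ H)
    (β : H ⊗ A ⟶ H) (ψ : H ⟶ H ⊗ A)
    (hA : BraidedLie.IsBraidedLieBialgebra A brA δA)
    (hH : BraidedLie.IsRightInfinitesimalBraidedLieBialgebra brA δA brH δH β ψ) :
    BraidedLie.IsBraidedLieBialgebra (A ⊞ H)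
      (BraidedLie.bisumBracket brA brH β) (BraidedLie.bisumCobracket δA δH ψ) := by
  exact BraidedLie.isBraidedLieBialgebra_bisum hsymm hA hH
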